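/- A state is a positive semidefinite matrix of trace one in $M_3(\mathbb{C})\otimes M_3(\mathbb{C})$. Let $\mathcal{AP}_{3,3}$ be the set of absolutely PPT states, i.e. of those states $\rho$ such that $(\mathrm{id}_3\otimes T)(U\rho U^\dagger)$ is positive semidefinite for every unitary matrix $U$ of order $9$, where $T$ is the transpose map on $M_3(\mathbb{C})$. A state $\rho\in\mathcal{AP}_{3,3}$ is called an interior point of $\mathcal{AP}_{3,3}$ if there is $\varepsilon\in(0,1)$ with $\frac{1}{1-\varepsilon}\left(\rho-\frac{\varepsilon}{9}I_9\right)\in\mathcal{AP}_{3,3}$, and a boundary point otherwise. For a Hermitian matrix $M$ of order $9$ let $\lambda(M)=(\lambda_1(M),\dots,\lambda_9(M))$ be its vector of eigenvalues, counted with multiplicity, in non-increasing order; write $A\succ B$ if $\sum_{i=1}^k\lambda_i(A)\ge\sum_{i=1}^k\lambda_i(B)$ for $k=1,\dots,8$ and $\sum_{i=1}^9\lambda_i(A)=\sum_{i=1}^9\lambda_i(B)$. Theorem. Let $\rho$ be a boundary point of $\mathcal{AP}_{3,3}$. If $\sigma$ is a state with $\sigma\succ\rho$ and $\lambda(\sigma)\neq\lambda(\rho)$,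 then $\sigma\notin\mathcal{AP}_{3,3}$. -/

import Mathlib

open scoped ComplexOrder

noncomputable section

/-- The rearrangement of a real vector in non-increasing order. -/
def decreasingRearrangement {N : ℕ} (x : Fin N → ℝ) : Fin N → ℝ :=
  x ∘ Tuple.sort (fun i => -x i)

/-- `VecMajorizes y x` means `y ≻ x`: for every `k ≤ N` the sum of the `k` largest entries of `x`
is at most that of `y`, and the total sums agree. -/
def VecMajorizes {N : ℕ} (y x : Fin N → ℝ) : Prop :=
  (∀ k : ℕ, k ≤ N →
    ∑ i : Fin N with i.val < k, decreasingRearrangement x i ≤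
      ∑ i : Fin N with i.val < k, decreasingRearrangement y i) ∧
  ∑ i : Fin N, decreasingRearrangement x i = ∑ i : Fin N, decreasingRearrangement y i

/-- The eigenvalues of a Hermitian matrix, with multiplicity, listed in non-increasing order. -/
def eigenvalueVector {ι : Type*} [Fintype ι] [DecidableEq ι] {M : Matrix ι ι ℂ}
    (hM : M.IsHermitian) : Fin (Fintype.card ι) → ℝ :=
  hM.eigenvalues₀

/-- `HermMajorizes hA hB` means `A ≻ B`, that is, `λ(A) ≻ λ(B)`. -/
def HermMajorizes {ι : Type*} [Fintype ι] [DecidableEq ι] {A B : Matrix ι ι ℂ}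
    (hA : A.IsHermitian) (hB : B.IsHermitian) : Prop :=
  VecMajorizes (eigenvalueVector hA) (eigenvalueVector hB)

/-- Matrices in `M_m(ℂ) ⊗ M_n(ℂ)`, acting on `ℂ^m ⊗ ℂ^n` with its product basis. -/
abbrev BipartiteMatrix (m n : ℕ) : Type :=
  Matrix (Fin m × Fin n) (Fin m × Fin n) ℂ

/-- An `m × n` (normalized) quantum state: positive semidefinite with trace one. -/
structure IsState {m n : ℕ} (ρ : BipartiteMatrix m n) : Prop where
  posSemidef : ρ.PosSemidef
  trace_eq_one : ρ.trace = 1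

theorem IsState.isHermitian {m n : ℕ} {ρ : BipartiteMatrix m n} (h : IsState ρ) :
    ρ.IsHermitian :=
  h.posSemidef.isHermitian

/-- The partial transpose `(id_m ⊗ T)(ρ)`, with `T` the transpose map on `M_n(ℂ)`. -/
def partialTranspose {m n : ℕ} (ρ : BipartiteMatrix m n) : BipartiteMatrix m n :=
  Matrix.of fun p q => ρ (p.1, q.2) (q.1, p.2)

/-- The set of absolutely PPT states: states `ρ` such that `U ρ U†` has positive semidefinite
partial transpose for every (global) unitary `U`. -/
def AbsolutelyPPT (m n : ℕ) : Set (BipartiteMatrix m n) :=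
  {ρ | IsState ρ ∧ ∀ U ∈ Matrix.unitaryGroup (Fin m × Fin n) ℂ,
    (partialTranspose (U * ρ * U.conjTranspose)).PosSemidef}

/-- `ρ` is an interior point of the set of absolutely PPT states: it lies in this set, and so does
`(1 - ε)⁻¹ (ρ - ε I / (m n))` for some `0 < ε < 1`. -/
def IsInteriorPointAP {m n : ℕ} (ρ : BipartiteMatrix m n) : Prop :=
  ρ ∈ AbsolutelyPPT m n ∧ ∃ ε : ℝ, 0 < ε ∧ ε < 1 ∧
    (1 / (1 - ε)) • (ρ - (ε / ((m : ℝ) * (n : ℝ))) • (1 : BipartiteMatrix m n)) ∈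
      AbsolutelyPPT m n

/-- A boundary point is an element of the set of absolutely PPT states that is not an interior
point. -/
def IsBoundaryPointAP {m n : ℕ} (ρ : BipartiteMatrix m n) : Prop :=
  ρ ∈ AbsolutelyPPT m n ∧ ¬ IsInteriorPointAP ρ

end

open scoped ComplexOrder

/-! Let `x` be the decreasing spectrum of a state. Testing a partial transpose on a vector with
Schmidt coefficients `p` pairs the state with an operator of eigenvalues `p i ^ 2` and `± p i * p
j`; over all unitaries the pairing is minimized at a permutation, by Birkhoff. So absolute PPT means
`∑ x k * pairMonomial p (π k) ≥ 0` for all `p` and all labellings `π`, and by compactness a boundary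
state attains zero at some nonnegative `p ≠ 0` (`IsBoundaryPointAP.exists_sum_nonpos`).

By rearrangement the zero occurs with the monomial values `v` sorted increasingly. If `y` majorizes
`x`, then `∑ y k * v k ≤ ∑ x k * v k = 0`, so an absolutely PPT `y` vanishes there too. Abel
summation then makes the partial sums of `y - x` vanish wherever `v` jumps. Where `v` is constant,
both `x` and `y` are constant (`weight_eq_of_pairMonomial_eq`): exchanging tied labels preserves the
zero, and a zero is a minimum of a nonnegative quadratic form, so the gradient vanishes before and
after the exchange. Hence `y = x`. The argument works in every dimension `n × n` with `n ≥ 1`. -/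

/-! ### Signed monomials and the weights at a zero -/

/-- The sign of the eigenvalue `± q i * q j` of a partially transposed Schmidt vector attached to
the index pair `(i, j)`. -/
def pairSign {n : ℕ} (a : Fin n × Fin n) : ℝ := if a.1 ≤ a.2 then 1 else -1

/-- For a Schmidt vector with coefficients `q`, the family `pairMonomial q` lists the eigenvalues
of the partial transpose of the corresponding rank one projection. -/
def pairMonomial {n : ℕ} (q : Fin n → ℝ) (a : Fin n × Fin n) : ℝ :=
  pairSign a * (q a.1 * q a.2)

/-- The polar form of `pairMonomial`. -/
def pairPolar {n : ℕ} (p q : Fin n → ℝ) (a : Fin n × Fin n) : ℝ :=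
  pairSign a * (p a.1 * q a.2 + q a.1 * p a.2)

theorem pairMonomial_add_smul {n : ℕ} (p q : Fin n → ℝ) (t : ℝ) (a : Fin n × Fin n) :
    pairMonomial (p + t • q) a =
      pairMonomial p a + t * pairPolar p q a + t ^ 2 * pairMonomial q a := by
  simp only [pairMonomial, pairPolar, Pi.add_apply, Pi.smul_apply, smul_eq_mul]
  ring

theorem pairMonomial_smul {n : ℕ} (q : Fin n → ℝ) (t : ℝ) (a : Fin n × Fin n) :
    pairMonomial (t • q) a = t ^ 2 * pairMonomial q a := by
  simp only [pairMonomial, Pi.smul_apply, smul_eq_mul]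
  ring

theorem pairSign_ne_zero {n : ℕ} (a : Fin n × Fin n) : pairSign a ≠ 0 := by
  unfold pairSign
  split_ifs <;> norm_num

theorem eq_zero_of_forall_mul_add_sq_mul_nonneg {b c : ℝ}
    (h : ∀ t : ℝ, 0 ≤ t * b + t ^ 2 * c) : b = 0 := by
  have h1 : ∀ t : ℝ, 0 ≤ c * (t * t) + b * t + 0 := fun t => by linarith [h t]
  have h2 := discrim_le_zero h1
  simp only [discrim] at h2
  exact pow_eq_zero_iff two_ne_zero |>.1 (le_antisymm (by linarith) (sq_nonneg b))

/-- A zero of a nonnegative quadratic form is a minimum, so every directional derivative vanishes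
there. This needs nonnegativity at all real `q`, including those with negative entries. -/
theorem sum_mul_pairPolar_eq_zero {n : ℕ} {κ : Type*} [Fintype κ] {x : κ → ℝ}
    {π : κ → Fin n × Fin n} (h : ∀ q, 0 ≤ ∑ k, x k * pairMonomial q (π k)) {p : Fin n → ℝ}
    (hp : ∑ k, x k * pairMonomial p (π k) = 0) (q : Fin n → ℝ) :
    ∑ k, x k * pairPolar p q (π k) = 0 := by
  refine eq_zero_of_forall_mul_add_sq_mul_nonneg
    (c := ∑ k, x k * pairMonomial q (π k)) fun t => ?_
  have h1 := h (p + t • q)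
  simp only [pairMonomial_add_smul, mul_add, Finset.sum_add_distrib, hp] at h1
  rw [Finset.mul_sum, Finset.mul_sum]
  convert h1 using 1
  rw [zero_add]
  congr 1 <;> exact Finset.sum_congr rfl fun k _ => by ring

/-- Swapping two labels changes a weighted sum by the product of the differences. -/
theorem sum_mul_swap {α κ : Type*} [Fintype κ] [DecidableEq κ] (x : κ → ℝ) (f : α → ℝ)
    (π : κ ≃ α) (k l : κ) :
    ∑ i, x i * f (((Equiv.swap k l).trans π) i) =
      ∑ i, x i * f (π i) - (x k - x l) * (f (π k) - f (π l)) := by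
  rcases eq_or_ne k l with rfl | hkl
  · simp
  have h : ∀ g : κ → ℝ, ∑ i, g i = g k + g l + ∑ i ∈ (Finset.univ.erase k).erase l, g i := by
    intro g
    rw [← Finset.add_sum_erase _ g (Finset.mem_univ k),
      ← Finset.add_sum_erase _ g (Finset.mem_erase.2 ⟨hkl.symm, Finset.mem_univ l⟩), add_assoc]
  rw [h, h fun i => x i * f (π i)]
  have h2 : ∑ i ∈ (Finset.univ.erase k).erase l, x i * f (((Equiv.swap k l).trans π) i) =
      ∑ i ∈ (Finset.univ.erase k).erase l, x i * f (π i) := by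
    refine Finset.sum_congr rfl fun i hi => ?_
    simp only [Finset.mem_erase, Finset.mem_univ, and_true] at hi
    simp [Equiv.swap_apply_of_ne_of_ne hi.2 hi.1]
  rw [h2]
  simp
  ring

/-- Exchanging tied labels gives a second form with a zero at `p`. Both gradients vanish at `p`, and
they differ by `x k - x l` times the difference of the two monomial gradients. -/
theorem eq_or_pairPolar_eq {n : ℕ} {κ : Type*} [Fintype κ] [DecidableEq κ] {x : κ → ℝ}
    (h : ∀ (π : κ ≃ Fin n × Fin n) (q : Fin n → ℝ), 0 ≤ ∑ k, x k * pairMonomial q (π k))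
    {p : Fin n → ℝ} {π : κ ≃ Fin n × Fin n} (hp : ∑ k, x k * pairMonomial p (π k) = 0) {k l : κ}
    (hkl : pairMonomial p (π k) = pairMonomial p (π l)) :
    x k = x l ∨ ∀ q, pairPolar p q (π k) = pairPolar p q (π l) := by
  by_contra! hne
  obtain ⟨hx, q, hq⟩ := hne
  have h1 : ∑ i, x i * pairMonomial p (((Equiv.swap k l).trans π) i) = 0 := by
    rw [sum_mul_swap, hp, hkl]; simp
  have h2 := sum_mul_pairPolar_eq_zero (h _) h1 q
  rw [sum_mul_swap x (pairPolar p q), sum_mul_pairPolar_eq_zero (h _) hp q] at h2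
  have h3 : (x k - x l) * (pairPolar p q (π k) - pairPolar p q (π l)) = 0 := by linarith
  rcases mul_eq_zero.1 h3 with h4 | h4
  · exact hx (sub_eq_zero.1 h4)
  · exact hq (sub_eq_zero.1 h4)

/-- A nonzero monomial at a nonnegative point is determined by its gradient. -/
theorem eq_of_pairPolar_eq {n : ℕ} {p : Fin n → ℝ} (hp : ∀ i, 0 ≤ p i) {a b : Fin n × Fin n}
    (hab : pairMonomial p a = pairMonomial p b) (ha : pairMonomial p a ≠ 0)
    (h : ∀ q, pairPolar p q a = pairPolar p q b) : a = b := by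
  obtain ⟨i, j⟩ := a
  obtain ⟨k, l⟩ := b
  have hb := hab ▸ ha
  simp only [pairMonomial, ne_eq, mul_eq_zero, not_or] at ha hb
  have hi := lt_of_le_of_ne (hp i) (Ne.symm ha.2.1)
  have hj := lt_of_le_of_ne (hp j) (Ne.symm ha.2.2)
  have hk := lt_of_le_of_ne (hp k) (Ne.symm hb.2.1)
  have hl := lt_of_le_of_ne (hp l) (Ne.symm hb.2.2)
  have hij := mul_pos hi hj
  have hkl := mul_pos hk hl
  have hs : pairSign (i, j) = pairSign (k, l) := by
    simp only [pairMonomial, pairSign] at hab ⊢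
    split_ifs at hab ⊢ <;> first | rfl | linarith
  have h' : ∀ q : Fin n → ℝ, p i * q j + q i * p j = p k * q l + q k * p l := fun q => by
    have := h q
    simp only [pairPolar, hs] at this
    exact mul_left_cancel₀ (pairSign_ne_zero _) this
  -- Differentiating along the basis vector at `a` gives at least `p b > 0` on the left, and zero on
  -- the right unless `a` is `c` or `d`.
  have mem : ∀ a b c d, 0 < p a → 0 < p b →
      (∀ q : Fin n → ℝ, p a * q b + q a * p b = p c * q d + q c * p d) → a = c ∨ a = d := by
    intro a b c d ha hb h
    by_contra! hne
    have h1 := h (Pi.single a 1)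
    rw [Pi.single_eq_of_ne hne.1.symm, Pi.single_eq_of_ne hne.2.symm, Pi.single_eq_same,
      Pi.single_apply] at h1
    split_ifs at h1 <;> linarith
  have m1 := mem i j k l hi hj h'
  have m2 := mem j i l k hj hi fun q => by linarith [h' q]
  have m3 := mem k l i j hk hl fun q => (h' q).symm
  have m4 := mem l k j i hl hk fun q => by linarith [h' q]
  have hcase : (i = k ∧ j = l) ∨ (i = l ∧ j = k) := by
    rcases m1 with rfl | rfl <;> rcases m2 with rfl | rfl <;> simp_all
  rcases hcase with ⟨rfl, rfl⟩ | ⟨rfl, rfl⟩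
  · rfl
  · simp only [pairSign] at hs
    split_ifs at hs with h1 h2 h2
    · rw [le_antisymm h1 h2]
    · norm_num at hs
    · norm_num at hs
    · exact absurd (le_total i j) (by tauto)

/-- At a nonnegative zero of a nonnegative weighted sum of monomials, coinciding monomials carry
coinciding weights. -/
theorem weight_eq_of_pairMonomial_eq {n : ℕ} {κ : Type*} [Fintype κ] {x : κ → ℝ}
    (h : ∀ (π : κ ≃ Fin n × Fin n) (q : Fin n → ℝ), 0 ≤ ∑ k, x k * pairMonomial q (π k))
    {p : Fin n → ℝ} (hp0 : ∀ i, 0 ≤ p i) (hp1 : p ≠ 0) {π : κ ≃ Fin n × Fin n}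
    (hp : ∑ k, x k * pairMonomial p (π k) = 0) {k l : κ}
    (hkl : pairMonomial p (π k) = pairMonomial p (π l)) : x k = x l := by
  classical
  rcases eq_or_pairPolar_eq h hp hkl with hx | hpol
  · exact hx
  by_cases h0 : pairMonomial p (π k) = 0
  · obtain ⟨i, hi⟩ : ∃ i, p i = 0 := by
      simp only [pairMonomial, mul_eq_zero, pairSign_ne_zero, false_or] at h0
      exact h0.elim (fun h => ⟨_, h⟩) fun h => ⟨_, h⟩
    obtain ⟨j, hj⟩ := Function.ne_iff.1 hp1
    have hij : i ≠ j := fun e => hj (e ▸ hi)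
    -- A third label `c` with value zero but a different gradient is tied with both `k` and `l`,
    -- which forces both weights to equal that of `c`.
    have key : ∀ c : Fin n × Fin n, pairMonomial p c = 0 →
        (∃ q, pairPolar p q (π k) ≠ pairPolar p q c) → x k = x l := by
      rintro c hc ⟨q, hq⟩
      have hc' : pairMonomial p (π (π.symm c)) = 0 := by simpa using hc
      have h1 := (eq_or_pairPolar_eq h hp (h0.trans hc'.symm)).resolve_right fun h =>
        hq (by simpa using h q)
      have h2 := (eq_or_pairPolar_eq h hp ((hkl.symm.trans h0).trans hc'.symm)).resolve_right
        fun h => hq (by simpa [hpol] using h q)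
      exact h1.trans h2.symm
    by_contra hx
    have h1 : ∀ c, pairMonomial p c = 0 → ∀ q, pairPolar p q (π k) = pairPolar p q c := by
      intro c hc
      by_contra! h
      exact hx (key c hc h)
    -- Such a label exists: along the basis vector at `i`, the zero monomials at `(i, j)` and `(j,
    -- i)` have the opposite nonzero derivatives `± p j`.
    have h2 := (h1 (i, j) (by simp [pairMonomial, hi]) (Pi.single i 1)).symm.trans
      (h1 (j, i) (by simp [pairMonomial, hi]) (Pi.single i 1))
    simp only [Pi.zero_apply] at hj
    simp only [pairPolar, pairSign, hi, Pi.single_apply, hij.symm] at h2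
    rcases lt_or_gt_of_ne hij with h3 | h3 <;>
      simp [h3.le, not_le.2 h3] at h2 <;> exact hj (by linarith)
  · rw [π.injective (eq_of_pairPolar_eq hp0 hkl h0 hpol)]

/-! ### Abel summation and majorization -/

/-- If `d` has nonnegative partial sums, total sum zero, and pairs to a nonnegative value with
the monotone `v`, and if `d` is constant wherever `v` is, then `d = 0`. -/
theorem eq_zero_of_partialSums_nonneg {N : ℕ} {d v : ℕ → ℝ}
    (hD : ∀ k ≤ N, 0 ≤ ∑ i ∈ Finset.range k, d i) (hN : ∑ i ∈ Finset.range N, d i = 0)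
    (hv : ∀ i, i + 1 < N → v i ≤ v (i + 1))
    (hdv : 0 ≤ ∑ i ∈ Finset.range N, v i * d i)
    (htie : ∀ i, i + 1 < N → v i = v (i + 1) → d i = d (i + 1)) :
    ∀ i < N, d i = 0 := by
  have abel : ∀ w : ℕ → ℝ, ∑ i ∈ Finset.range N, w i * d i =
      -∑ i ∈ Finset.range (N - 1), (w (i + 1) - w i) * ∑ j ∈ Finset.range (i + 1), d j := by
    intro w
    have := Finset.sum_range_by_parts w d N
    simp only [smul_eq_mul, hN] at this
    rw [this]; ring
  have hnn : ∀ i ∈ Finset.range (N - 1),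
      0 ≤ (v (i + 1) - v i) * ∑ j ∈ Finset.range (i + 1), d j := by
    intro i hi
    have hi' : i + 1 < N := by have := Finset.mem_range.1 hi; omega
    exact mul_nonneg (sub_nonneg.2 (hv i hi')) (hD _ hi'.le)
  rw [abel v] at hdv
  have hz := (Finset.sum_eq_zero_iff_of_nonneg hnn).1
    (le_antisymm (by linarith) (Finset.sum_nonneg hnn))
  -- Summation by parts with `d` as its own weight: each term vanishes, since either `v` is tied and
  -- `d` does not change, or the partial sum is zero.
  have hsq : ∑ i ∈ Finset.range N, d i * d i = 0 := by
    rw [abel d, Finset.sum_eq_zero, neg_zero]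
    intro i hi
    have hi' : i + 1 < N := by have := Finset.mem_range.1 hi; omega
    rcases mul_eq_zero.1 (hz i hi) with h | h
    · rw [htie i hi' (by linarith)]; simp
    · rw [h, mul_zero]
  intro i hi
  exact mul_self_eq_zero.1 ((Finset.sum_eq_zero_iff_of_nonneg fun i _ => mul_self_nonneg _).1 hsq i
    (Finset.mem_range.2 hi))

theorem decreasingRearrangement_of_antitone {N : ℕ} {x : Fin N → ℝ} (hx : Antitone x) :
    decreasingRearrangement x = x := by
  have : Tuple.sort (fun i => -x i) = Equiv.refl _ :=
    Tuple.sort_eq_refl_iff_monotone.2 fun i j h => neg_le_neg (hx h)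
  simp [decreasingRearrangement, this]

theorem sum_filter_lt_eq_sum_range {N k : ℕ} (hk : k ≤ N) (x : Fin N → ℝ) :
    ∑ i : Fin N with i.val < k, x i =
      ∑ i ∈ Finset.range k, if h : i < N then x ⟨i, h⟩ else 0 := by
  rw [Finset.sum_filter, Finset.sum_fin_eq_sum_range]
  rw [← Finset.sum_subset (Finset.range_mono hk)]
  · refine Finset.sum_congr rfl fun i hi => ?_
    simp [Finset.mem_range.1 hi]
  · intro i _ hi
    simp [Finset.mem_range] at hi
    simp [not_lt.2 hi]

/-- If the weights `x` admit a nontrivial zero at a nonnegative point, then no weights `y ≠ x`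
majorizing `x` are nonnegative on all labelled sums of monomials. -/
theorem eq_of_vecMajorizes {n N : ℕ} {x y : Fin N → ℝ} (hx : Antitone x) (hy : Antitone y)
    (hmaj : VecMajorizes y x)
    (hxn : ∀ (π : Fin N ≃ Fin n × Fin n) (q : Fin n → ℝ), 0 ≤ ∑ k, x k * pairMonomial q (π k))
    (hyn : ∀ (π : Fin N ≃ Fin n × Fin n) (q : Fin n → ℝ), 0 ≤ ∑ k, y k * pairMonomial q (π k))
    {p : Fin n → ℝ} (hp0 : ∀ i, 0 ≤ p i) (hp1 : p ≠ 0) {π : Fin N ≃ Fin n × Fin n}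
    (hp : ∑ k, x k * pairMonomial p (π k) ≤ 0) : y = x := by
  set τ := Tuple.sort (fun k => pairMonomial p (π k)) with hτ
  set θ := τ.trans π with hθ
  set v : Fin N → ℝ := fun k => pairMonomial p (θ k) with hv
  have hvm : Monotone v := Tuple.monotone_sort (fun k => pairMonomial p (π k))
  have hanti : Antivary x v := hx.antivary hvm
  have hxv : ∑ k, x k * v k ≤ 0 := by
    -- Pairing the decreasing `x` with the increasing `v` minimizes the sum over all labellings, so
    -- the given nonpositive value bounds it from above.
    refine (hanti.sum_mul_le_sum_mul_comp_perm (σ := τ.symm)).trans (le_of_eq_of_le ?_ hp)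
    simp [hv, hθ]
  have hxv0 : ∑ k, x k * v k = 0 := le_antisymm hxv (hxn θ p)
  rw [VecMajorizes, decreasingRearrangement_of_antitone hx,
    decreasingRearrangement_of_antitone hy] at hmaj
  let ext (z : Fin N → ℝ) (i : ℕ) : ℝ := if h : i < N then z ⟨i, h⟩ else 0
  have hext : ∀ (z : Fin N → ℝ) (i : ℕ) (h : i < N), ext z i = z ⟨i, h⟩ := fun z i h => by
    simp [ext, h]
  have hsum : ∀ z : Fin N → ℝ, ∑ i, z i = ∑ i ∈ Finset.range N, ext z i := fun z => by
    rw [Finset.sum_fin_eq_sum_range]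
  have hyv0 : 0 ≤ ∑ k, y k * v k := hyn θ p
  have hD : ∀ k ≤ N, 0 ≤ ∑ i ∈ Finset.range k, (ext y i - ext x i) := by
    intro k hk
    have := hmaj.1 k hk
    rw [sum_filter_lt_eq_sum_range hk, sum_filter_lt_eq_sum_range hk] at this
    rw [Finset.sum_sub_distrib]
    exact sub_nonneg.2 this
  have hN : ∑ i ∈ Finset.range N, (ext y i - ext x i) = 0 := by
    rw [Finset.sum_sub_distrib, ← hsum, ← hsum, hmaj.2, sub_self]
  have hdv : ∑ i ∈ Finset.range N, ext v i * (ext y i - ext x i) = ∑ k, y k * v k := by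
    rw [← sub_zero (∑ k, y k * v k), ← hxv0, ← Finset.sum_sub_distrib, hsum]
    refine Finset.sum_congr rfl fun i hi => ?_
    have hi' := Finset.mem_range.1 hi
    simp only [hext _ i hi']
    ring
  -- Majorization against an increasing `v` can only lower the pairing, so `y` attains zero at the
  -- same point and labelling as `x`.
  have hyv : ∑ k, y k * v k = 0 := by
    refine le_antisymm ?_ hyv0
    rw [← hdv]
    have := Finset.sum_range_by_parts (ext v) (fun i => ext y i - ext x i) N
    simp only [smul_eq_mul, hN, mul_zero, zero_sub] at this
    rw [this, neg_nonpos]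
    refine Finset.sum_nonneg fun i hi => ?_
    have hi' : i + 1 < N := by have := Finset.mem_range.1 hi; omega
    refine mul_nonneg ?_ (hD _ hi'.le)
    rw [hext _ i (by omega), hext _ _ hi', sub_nonneg]
    exact hvm (by simp)
  have key := eq_zero_of_partialSums_nonneg (v := ext v) hD hN
    (fun i hi => by
      rw [hext _ i (by omega), hext _ _ hi]
      exact hvm (by simp))
    (hdv ▸ hyv0)
    (fun i hi hvi => by
      rw [hext _ i (by omega), hext _ _ hi] at hvi
      simp only [hext _ i (by omega), hext _ _ hi]
      rw [weight_eq_of_pairMonomial_eq hxn hp0 hp1 hxv0 hvi,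
        weight_eq_of_pairMonomial_eq hyn hp0 hp1 hyv hvi])
  funext i
  have := key i i.2
  simp only [hext _ _ i.2] at this
  exact sub_eq_zero.1 this

/-! ### Singular value decomposition -/

/-- Singular value decomposition of a square complex matrix. -/
theorem exists_unitary_mul_diagonal_mul_unitary {n : ℕ} (A : Matrix (Fin n) (Fin n) ℂ) :
    ∃ U ∈ Matrix.unitaryGroup (Fin n) ℂ, ∃ V ∈ Matrix.unitaryGroup (Fin n) ℂ, ∃ p : Fin n → ℝ,
      (∀ i, 0 ≤ p i) ∧ A = U * Matrix.diagonal (fun i => (p i : ℂ)) * V := by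
  have hH : (A.conjTranspose * A).IsHermitian := Matrix.isHermitian_conjTranspose_mul_self A
  set W : Matrix (Fin n) (Fin n) ℂ := (hH.eigenvectorUnitary : Matrix (Fin n) (Fin n) ℂ) with hW
  have hWu : W ∈ Matrix.unitaryGroup (Fin n) ℂ := hH.eigenvectorUnitary.2
  have hWW : star W * W = 1 := Matrix.mem_unitaryGroup_iff'.1 hWu
  have hWW' : W * star W = 1 := Matrix.mem_unitaryGroup_iff.1 hWu
  let v : Fin n → EuclideanSpace ℂ (Fin n) := fun k => WithLp.toLp 2 fun i => (A * W) i k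
  have hAW : (A * W).conjTranspose * (A * W) =
      Matrix.diagonal (fun k => (hH.eigenvalues k : ℂ)) := by
    have h := hH.spectral_theorem
    rw [Unitary.conjStarAlgAut_apply] at h
    have h' := congrArg (fun X => star W * X * W) h
    simp only [← hW, Matrix.mul_assoc, hWW, Matrix.mul_one] at h'
    rw [← Matrix.mul_assoc (star W) W, hWW, Matrix.one_mul] at h'
    rw [Matrix.conjTranspose_mul, Matrix.mul_assoc]
    exact h'
  have hv : ∀ k l, inner ℂ (v k) (v l) = if k = l then (hH.eigenvalues k : ℂ) else 0 := by
    intro k l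
    have h := congrFun (congrFun hAW k) l
    rw [Matrix.diagonal_apply, Matrix.mul_apply] at h
    rw [← h, PiLp.inner_apply]
    exact Finset.sum_congr rfl fun i _ => by simp [v, mul_comm]
  -- The columns of `A * W` are orthogonal but may vanish. Only the nonzero ones are normalized; the
  -- basis vectors filling the other places are multiplied by the singular value zero.
  let s : Set (Fin n) := {k | v k ≠ 0}
  let u : Fin n → EuclideanSpace ℂ (Fin n) := fun k => ((‖v k‖ : ℂ)⁻¹) • v k
  have hu : Orthonormal ℂ (s.domRestrict u) := by
    constructor
    · rintro ⟨k, hk⟩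
      have : ‖v k‖ ≠ 0 := norm_ne_zero_iff.2 hk
      simp [Set.domRestrict, u, norm_smul, this]
    · rintro ⟨k, hk⟩ ⟨l, hl⟩ hkl
      have hkl' : k ≠ l := fun h => hkl (Subtype.ext h)
      simp [Set.domRestrict, u, inner_smul_left, inner_smul_right, hv, hkl']
  obtain ⟨b, hb⟩ := hu.exists_orthonormalBasis_extension_of_card_eq (by simp)
  let U : Matrix (Fin n) (Fin n) ℂ := Matrix.of fun i k => b k i
  have hU : U ∈ Matrix.unitaryGroup (Fin n) ℂ := by
    rw [Matrix.mem_unitaryGroup_iff']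
    ext k l
    have h := orthonormal_iff_ite.1 b.orthonormal k l
    rw [PiLp.inner_apply] at h
    rw [Matrix.one_apply, ← h, Matrix.mul_apply]
    exact Finset.sum_congr rfl fun i _ => by simp [U, mul_comm]
  refine ⟨U, hU, star W, Unitary.star_mem hWu, fun k => ‖v k‖, fun k => norm_nonneg _, ?_⟩
  have h : A * W = U * Matrix.diagonal (fun i => ((‖v i‖ : ℝ) : ℂ)) := by
    ext i k
    rw [Matrix.mul_diagonal]
    by_cases hk : v k = 0
    · have : (A * W) i k = v k i := rfl
      rw [this, hk]; simp
    · have h1 : b k = u k := hb k hk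
      have h2 : (‖v k‖ : ℂ) ≠ 0 := by simpa using hk
      have : (A * W) i k = v k i := rfl
      simp only [U, Matrix.of_apply, h1, u, this, PiLp.smul_apply, smul_eq_mul]
      field_simp
  rw [← h, Matrix.mul_assoc, hWW', Matrix.mul_one]

/-! ### Partial transposes of Schmidt projections -/

/-- The operator `∑ p i p j |j i⟩⟨i j|`, the partial transpose of the rank one projection onto the
Schmidt vector with coefficients `p`. -/
def swapWeight {n : ℕ} (p : Fin n → ℝ) : BipartiteMatrix n n :=
  Matrix.of fun a b => if a = b.swap then ((p b.1 * p b.2 : ℝ) : ℂ) else 0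

/-- The diagonal entries of `swapDiagonalizer`. -/
noncomputable def swapDiagonalizerDiag {n : ℕ} (a : Fin n × Fin n) : ℝ :=
  if a.1 = a.2 then 1 else pairSign a * (√2)⁻¹

/-- The entries of `swapDiagonalizer` at the positions `(a.swap, a)`. -/
noncomputable def swapDiagonalizerSwap {n : ℕ} (a : Fin n × Fin n) : ℝ :=
  if a.1 = a.2 then 0 else (√2)⁻¹

/-- A Hermitian unitary matrix whose columns are eigenvectors of every `swapWeight p`. -/
noncomputable def swapDiagonalizer (n : ℕ) : BipartiteMatrix n n :=
  Matrix.of fun a b => (if a = b then (swapDiagonalizerDiag b : ℂ) else 0) +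
    if a = b.swap then (swapDiagonalizerSwap b : ℂ) else 0

theorem pairSign_swap {n : ℕ} {a : Fin n × Fin n} (h : a.1 ≠ a.2) :
    pairSign a.swap = -pairSign a := by
  unfold pairSign
  rcases lt_or_gt_of_ne h with h | h <;> simp [h.le, not_le.2 h]

theorem pairSign_mul_self {n : ℕ} (a : Fin n × Fin n) : pairSign a * pairSign a = 1 := by
  unfold pairSign
  split_ifs <;> norm_num

theorem swapDiagonalizerSwap_swap {n : ℕ} (a : Fin n × Fin n) :
    swapDiagonalizerSwap a.swap = swapDiagonalizerSwap a := by
  simp [swapDiagonalizerSwap, eq_comm]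

theorem swap_eq_self_iff {n : ℕ} (a : Fin n × Fin n) : a.swap = a ↔ a.1 = a.2 := by
  constructor
  · intro h; exact (congrArg Prod.snd h)
  · intro h; exact Prod.ext h.symm h

theorem sum_mul_swapDiagonalizer {n : ℕ} (f : Fin n × Fin n → ℂ) (b : Fin n × Fin n) :
    ∑ a, f a * swapDiagonalizer n a b =
      f b * swapDiagonalizerDiag b + f b.swap * swapDiagonalizerSwap b := by
  simp [swapDiagonalizer, mul_add, Finset.sum_add_distrib]

theorem swapDiagonalizer_mul_self (n : ℕ) : swapDiagonalizer n * swapDiagonalizer n = 1 := by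
  ext a b
  rw [Matrix.mul_apply, sum_mul_swapDiagonalizer, Matrix.one_apply]
  simp only [swapDiagonalizer, Matrix.of_apply, Prod.swap_swap, swapDiagonalizerSwap_swap]
  have h2 : ((√2 : ℝ) : ℂ)⁻¹ * ((√2 : ℝ) : ℂ)⁻¹ = 1 / 2 := by
    rw [← mul_inv, ← Complex.ofReal_mul, Real.mul_self_sqrt (by norm_num)]; norm_num
  by_cases hb : b.1 = b.2
  · have hs := (swap_eq_self_iff b).2 hb
    simp [swapDiagonalizerDiag, swapDiagonalizerSwap, hb]
  · have hs : b ≠ b.swap := fun h => hb ((swap_eq_self_iff b).1 h.symm)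
    have hb' : b.swap.1 ≠ b.swap.2 := fun h => hb h.symm
    have hsq : (pairSign b : ℂ) * pairSign b = 1 := by exact_mod_cast pairSign_mul_self b
    simp only [swapDiagonalizerDiag, swapDiagonalizerSwap, hb, hb', if_false, pairSign_swap hb]
    by_cases h1 : a = b
    · subst h1
      simp only [hs, if_true, if_false]
      push_cast
      linear_combination (1 + (pairSign a : ℂ) * pairSign a) * h2 + (1 / 2) * hsq
    · by_cases h3 : a = b.swap
      · subst h3
        simp only [hs.symm, if_true, if_false]
        push_cast
        ring
      · simp [h1, h3]

theorem swapDiagonalizer_conjTranspose (n : ℕ) :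
    (swapDiagonalizer n).conjTranspose = swapDiagonalizer n := by
  ext a b
  simp only [swapDiagonalizer, Matrix.conjTranspose_apply, Matrix.of_apply, star_add]
  by_cases h1 : a = b
  · subst h1
    split_ifs <;> simp
  · by_cases h3 : a = b.swap
    · subst h3
      simp [Ne.symm h1, h1, swapDiagonalizerSwap_swap]
    · have : b ≠ a.swap := fun h => h3 (by rw [h, Prod.swap_swap])
      simp [h1, Ne.symm h1, h3, this]

theorem swapDiagonalizer_mem_unitaryGroup (n : ℕ) :
    swapDiagonalizer n ∈ Matrix.unitaryGroup (Fin n × Fin n) ℂ := by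
  rw [Matrix.mem_unitaryGroup_iff, Matrix.star_eq_conjTranspose, swapDiagonalizer_conjTranspose,
    swapDiagonalizer_mul_self]

theorem swapWeight_mul_swapDiagonalizer {n : ℕ} (p : Fin n → ℝ) :
    swapWeight p * swapDiagonalizer n =
      swapDiagonalizer n * Matrix.diagonal (fun a => (pairMonomial p a : ℂ)) := by
  ext a b
  rw [Matrix.mul_apply, sum_mul_swapDiagonalizer, Matrix.mul_diagonal]
  simp only [swapWeight, swapDiagonalizer, Matrix.of_apply, Prod.swap_swap, pairMonomial]
  by_cases hb : b.1 = b.2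
  · have hs := (swap_eq_self_iff b).2 hb
    simp only [swapDiagonalizerDiag, swapDiagonalizerSwap, hb, hs, pairSign]
    split_ifs <;> simp_all
  · have hs : b ≠ b.swap := fun h => hb ((swap_eq_self_iff b).1 h.symm)
    simp only [swapDiagonalizerDiag, swapDiagonalizerSwap, hb, if_false]
    have hsq : (pairSign b : ℂ) * pairSign b = 1 := by exact_mod_cast pairSign_mul_self b
    by_cases h1 : a = b
    · subst h1
      simp only [hs, if_true, if_false, Prod.fst_swap, Prod.snd_swap]
      push_cast
      linear_combination -((p a.1 : ℂ) * p a.2 * ((√2 : ℝ) : ℂ)⁻¹) * hsq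
    · by_cases h3 : a = b.swap
      · subst h3
        simp only [hs.symm, if_true, if_false]
        push_cast
        ring
      · simp [h1, h3]

theorem trace_mul_swapWeight {n : ℕ} (p : Fin n → ℝ) (Y : BipartiteMatrix n n) :
    (Y * swapWeight p).trace =
      ∑ a, (pairMonomial p a : ℂ) * (swapDiagonalizer n * Y * swapDiagonalizer n) a a := by
  have h : swapWeight p = swapDiagonalizer n *
      Matrix.diagonal (fun a => (pairMonomial p a : ℂ)) * swapDiagonalizer n := by
    rw [← swapWeight_mul_swapDiagonalizer, Matrix.mul_assoc, swapDiagonalizer_mul_self,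
      Matrix.mul_one]
  rw [h, ← Matrix.mul_assoc, Matrix.trace_mul_comm, ← Matrix.mul_assoc, ← Matrix.mul_assoc]
  simp [Matrix.trace, Matrix.mul_diagonal, mul_comm]

/-- The off-diagonal signs cancel in pairs. Consequently, subtracting `c` from every weight lowers a
labelled sum by exactly `c * ∑ i, p i ^ 2`. -/
theorem sum_pairMonomial {n : ℕ} (p : Fin n → ℝ) : ∑ a, pairMonomial p a = ∑ i, p i ^ 2 := by
  have h := trace_mul_swapWeight p 1
  rw [Matrix.one_mul, Matrix.mul_one, swapDiagonalizer_mul_self] at h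
  have h2 : (swapWeight p).trace = ∑ i, ((p i ^ 2 : ℝ) : ℂ) := by
    simp only [Matrix.trace, swapWeight, Matrix.diag_apply, Matrix.of_apply,
      eq_comm (b := Prod.swap _), swap_eq_self_iff, Fintype.sum_prod_type]
    simp [sq]
  rw [h2] at h
  simp only [Matrix.one_apply_eq, mul_one] at h
  exact_mod_cast h.symm

/-- The Schmidt vector `∑ p i |i i⟩`. -/
def schmidtVector {n : ℕ} (p : Fin n → ℝ) (a : Fin n × Fin n) : ℂ :=
  if a.1 = a.2 then (p a.1 : ℂ) else 0

theorem schmidtVector_dotProduct_partialTranspose {n : ℕ} (p : Fin n → ℝ)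
    (Y : BipartiteMatrix n n) :
    star (schmidtVector p) ⬝ᵥ (partialTranspose Y).mulVec (schmidtVector p) =
      (Y * swapWeight p).trace := by
  simp only [Matrix.trace, Matrix.diag_apply, Matrix.mul_apply, swapWeight, Matrix.of_apply,
    dotProduct, Matrix.mulVec, partialTranspose, schmidtVector, Pi.star_apply]
  simp only [Fintype.sum_prod_type, Prod.ext_iff, ite_and]
  simp [apply_ite (starRingEnd ℂ), Finset.mul_sum]
  exact Finset.sum_congr rfl fun i _ => Finset.sum_congr rfl fun j _ => by ring

/-- Transposing the second factor turns conjugation by `B` into conjugation by its entrywise complex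
conjugate, so local unitaries can be moved inside the partial transpose. -/
theorem partialTranspose_kronecker_conj {n : ℕ} (A B : Matrix (Fin n) (Fin n) ℂ)
    (X : BipartiteMatrix n n) :
    (Matrix.kroneckerMap (· * ·) A B).conjTranspose * partialTranspose X *
        Matrix.kroneckerMap (· * ·) A B =
      partialTranspose ((Matrix.kroneckerMap (· * ·) A (B.map star)).conjTranspose * X *
        Matrix.kroneckerMap (· * ·) A (B.map star)) := by
  ext ⟨i, j⟩ ⟨k, l⟩
  simp only [partialTranspose, Matrix.mul_apply, Matrix.of_apply, Matrix.conjTranspose_apply,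
    Matrix.kroneckerMap_apply, Matrix.map_apply, Fintype.sum_prod_type, Finset.sum_mul, star_mul',
    star_star]
  refine Finset.sum_congr rfl fun y _ => ?_
  rw [Finset.sum_comm]
  conv_rhs => rw [Finset.sum_comm]
  refine Finset.sum_congr rfl fun x _ => ?_
  rw [Finset.sum_comm]
  exact Finset.sum_congr rfl fun z _ => Finset.sum_congr rfl fun w _ => by ring

/-! ### From unitaries to permutations -/

theorem norm_sq_mem_doublyStochastic {ι : Type*} [Fintype ι] [DecidableEq ι] {K : Matrix ι ι ℂ}
    (hK : K ∈ Matrix.unitaryGroup ι ℂ) :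
    (Matrix.of fun a b => ‖K a b‖ ^ 2 : Matrix ι ι ℝ) ∈ doublyStochastic ℝ ι := by
  refine mem_doublyStochastic_iff_sum.2 ⟨fun a b => by simp, fun a => ?_, fun b => ?_⟩
  · have h := congrFun (congrFun (Matrix.mem_unitaryGroup_iff.1 hK) a) a
    simp only [Matrix.mul_apply, Matrix.star_apply, Matrix.one_apply_eq, RCLike.star_def,
      Complex.mul_conj'] at h
    simp only [Matrix.of_apply]
    exact_mod_cast h
  · have h := congrFun (congrFun (Matrix.mem_unitaryGroup_iff'.1 hK) b) b
    simp only [Matrix.mul_apply, Matrix.star_apply, Matrix.one_apply_eq, RCLike.star_def,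
      Complex.conj_mul'] at h
    simp only [Matrix.of_apply]
    exact_mod_cast h

/-- A bilinear form over a doubly stochastic matrix is at least its value at some permutation. -/
theorem exists_perm_sum_le {ι : Type*} [Fintype ι] [DecidableEq ι] {S : Matrix ι ι ℝ}
    (hS : S ∈ doublyStochastic ℝ ι) (m x : ι → ℝ) :
    ∃ τ : Equiv.Perm ι, ∑ a, m a * x (τ a) ≤ ∑ a, m a * ∑ b, S a b * x b := by
  obtain ⟨w, hw0, hw1, hw⟩ := exists_eq_sum_perm_of_mem_doublyStochastic hS
  have h : ∑ a, m a * ∑ b, S a b * x b =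
      ∑ τ : Equiv.Perm ι, w τ * ∑ a, m a * x (τ a) := by
    have h1 : ∀ a, ∑ b, S a b * x b = ∑ τ : Equiv.Perm ι, w τ * x (τ a) := by
      intro a
      rw [← hw]
      simp only [Matrix.sum_apply, Matrix.smul_apply, smul_eq_mul, Finset.sum_mul]
      rw [Finset.sum_comm]
      refine Finset.sum_congr rfl fun τ _ => ?_
      simp [Equiv.Perm.permMatrix, PEquiv.toMatrix_apply, Equiv.toPEquiv_apply]
    simp only [h1, Finset.mul_sum]
    rw [Finset.sum_comm]
    exact Finset.sum_congr rfl fun τ _ => Finset.sum_congr rfl fun a _ => by ring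
  by_contra! hlt
  have : ∑ τ : Equiv.Perm ι, w τ * (∑ a, m a * ∑ b, S a b * x b) <
      ∑ τ : Equiv.Perm ι, w τ * ∑ a, m a * x (τ a) := by
    obtain ⟨τ, hτ⟩ : ∃ τ, 0 < w τ := by
      by_contra! hle
      have := Finset.sum_nonpos fun τ (_ : τ ∈ Finset.univ) => hle τ
      linarith
    exact Finset.sum_lt_sum (fun τ _ => mul_le_mul_of_nonneg_left (hlt τ).le (hw0 τ))
      ⟨τ, Finset.mem_univ _, mul_lt_mul_of_pos_left (hlt τ) hτ⟩
  rw [← Finset.sum_mul, hw1, one_mul, h] at this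
  exact lt_irrefl _ this

theorem unitary_conj_diagonal_apply_self {ι : Type*} [Fintype ι] [DecidableEq ι]
    (K : Matrix ι ι ℂ) (x : ι → ℝ) (a : ι) :
    (K * Matrix.diagonal (fun b => (x b : ℂ)) * K.conjTranspose) a a =
      ((∑ b, ‖K a b‖ ^ 2 * x b : ℝ) : ℂ) := by
  rw [Matrix.mul_apply]
  push_cast
  refine Finset.sum_congr rfl fun b _ => ?_
  rw [Matrix.mul_diagonal, Matrix.conjTranspose_apply, RCLike.star_def, ← Complex.mul_conj']
  ring

/-- This is the singular value decomposition of the coefficient matrix of `ψ`; the right factor acts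
on the second tensor leg through its transpose. -/
theorem exists_schmidt {n : ℕ} (ψ : Fin n × Fin n → ℂ) :
    ∃ A ∈ Matrix.unitaryGroup (Fin n) ℂ, ∃ B ∈ Matrix.unitaryGroup (Fin n) ℂ, ∃ p : Fin n → ℝ,
      (∀ i, 0 ≤ p i) ∧ ψ = (Matrix.kroneckerMap (· * ·) A B).mulVec (schmidtVector p) := by
  obtain ⟨U, hU, V, hV, p, hp, h⟩ :=
    exists_unitary_mul_diagonal_mul_unitary (Matrix.of fun i j => ψ (i, j))
  refine ⟨U, hU, V.transpose, ?_, p, hp, ?_⟩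
  · rw [Matrix.mem_unitaryGroup_iff]
    have h1 := Matrix.mem_unitaryGroup_iff'.1 hV
    rw [Matrix.star_eq_conjTranspose] at h1 ⊢
    rw [← Matrix.transpose_one, ← h1, Matrix.transpose_mul]
    rfl
  · ext ⟨i, j⟩
    have h1 := congrFun (congrFun h i) j
    rw [Matrix.of_apply, Matrix.mul_apply] at h1
    rw [h1]
    simp only [Matrix.mulVec, dotProduct, schmidtVector, Fintype.sum_prod_type,
      Matrix.kroneckerMap_apply, Matrix.mul_diagonal, Matrix.transpose_apply]
    refine Finset.sum_congr rfl fun k _ => ?_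
    simp
    ring

theorem partialTranspose_isHermitian {n : ℕ} {X : BipartiteMatrix n n} (hX : X.IsHermitian) :
    (partialTranspose X).IsHermitian := by
  ext a b
  exact hX.apply _ _

theorem isHermitian_conj_diagonal {ι : Type*} [Fintype ι] [DecidableEq ι]
    (K : Matrix ι ι ℂ) (x : ι → ℝ) :
    (K * Matrix.diagonal (fun b => (x b : ℂ)) * K.conjTranspose).IsHermitian := by
  refine Matrix.isHermitian_mul_mul_conjTranspose _ ?_
  exact Matrix.isHermitian_diagonal_of_self_adjoint _ (funext fun b => Complex.conj_ofReal _)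

/-- The partial transpose of a Hermitian matrix with spectrum `x` is positive semidefinite as soon
as all labelled sums of monomials with weights `x` are nonnegative. -/
theorem partialTranspose_posSemidef_of_forall {n : ℕ} {K : BipartiteMatrix n n}
    (hK : K ∈ Matrix.unitaryGroup (Fin n × Fin n) ℂ) {x : Fin n × Fin n → ℝ}
    (h : ∀ p : Fin n → ℝ, (∀ i, 0 ≤ p i) → ∀ τ : Equiv.Perm (Fin n × Fin n),
      0 ≤ ∑ a, pairMonomial p a * x (τ a)) :
    (partialTranspose (K * Matrix.diagonal (fun b => (x b : ℂ)) * K.conjTranspose)).PosSemidef := by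
  refine Matrix.PosSemidef.of_dotProduct_mulVec_nonneg
    (partialTranspose_isHermitian (isHermitian_conj_diagonal _ _)) fun ψ => ?_
  obtain ⟨A, hA, B, hB, p, hp, rfl⟩ := exists_schmidt ψ
  set Q : BipartiteMatrix n n := Matrix.kroneckerMap (· * ·) A (B.map star) with hQ
  have hBs : B.map star ∈ Matrix.unitaryGroup (Fin n) ℂ := by
    rw [Matrix.mem_unitaryGroup_iff]
    have h1 := congrArg Matrix.transpose (Matrix.mem_unitaryGroup_iff.1 hB)
    rw [Matrix.transpose_mul, Matrix.transpose_one] at h1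
    rw [← h1]
    ext i j
    simp [Matrix.mul_apply, mul_comm]
  have hQu : Q ∈ Matrix.unitaryGroup (Fin n × Fin n) ℂ := Matrix.kronecker_mem_unitary hA hBs
  set K' : BipartiteMatrix n n := swapDiagonalizer n * (Q.conjTranspose * K) with hK'
  have hK'u : K' ∈ Matrix.unitaryGroup (Fin n × Fin n) ℂ :=
    mul_mem (swapDiagonalizer_mem_unitaryGroup n) (mul_mem (Unitary.star_mem hQu) hK)
  rw [Matrix.star_mulVec, ← Matrix.dotProduct_mulVec, Matrix.mulVec_mulVec, Matrix.mulVec_mulVec,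
    partialTranspose_kronecker_conj, schmidtVector_dotProduct_partialTranspose,
    trace_mul_swapWeight]
  -- All unitaries merge into `K'`, so the diagonal entries are doubly stochastic averages of `x`.
  have hconj : swapDiagonalizer n * (Q.conjTranspose *
      (K * Matrix.diagonal (fun b => (x b : ℂ)) * K.conjTranspose) * Q) * swapDiagonalizer n =
      K' * Matrix.diagonal (fun b => (x b : ℂ)) * K'.conjTranspose := by
    rw [hK', Matrix.conjTranspose_mul, Matrix.conjTranspose_mul, swapDiagonalizer_conjTranspose,
      Matrix.conjTranspose_conjTranspose]
    simp only [Matrix.mul_assoc]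
  rw [hconj]
  simp only [unitary_conj_diagonal_apply_self]
  obtain ⟨τ, hτ⟩ := exists_perm_sum_le (norm_sq_mem_doublyStochastic hK'u) (pairMonomial p) x
  have := (h p hp τ).trans hτ
  simp only [Matrix.of_apply] at this
  exact_mod_cast this

theorem permMatrix_mem_unitaryGroup {ι : Type*} [Fintype ι] [DecidableEq ι] (τ : Equiv.Perm ι) :
    (τ.permMatrix ℂ) ∈ Matrix.unitaryGroup ι ℂ := by
  rw [Matrix.mem_unitaryGroup_iff]
  ext a b
  simp [Matrix.mul_apply, Matrix.star_apply, Equiv.Perm.permMatrix, PEquiv.toMatrix_apply,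
    Equiv.toPEquiv_apply, Matrix.one_apply, eq_comm]

/-- If all unitary conjugates of a Hermitian matrix with spectrum `x` have positive semidefinite
partial transpose, then all labelled sums of monomials with weights `x` are nonnegative. -/
theorem sum_pairMonomial_nonneg {n : ℕ} {ρ K : BipartiteMatrix n n}
    (hK : K ∈ Matrix.unitaryGroup (Fin n × Fin n) ℂ) {x : Fin n × Fin n → ℝ}
    (hρ : ρ = K * Matrix.diagonal (fun b => (x b : ℂ)) * K.conjTranspose)
    (h : ∀ U ∈ Matrix.unitaryGroup (Fin n × Fin n) ℂ,
      (partialTranspose (U * ρ * U.conjTranspose)).PosSemidef)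
    (p : Fin n → ℝ) (τ : Equiv.Perm (Fin n × Fin n)) : 0 ≤ ∑ a, pairMonomial p a * x (τ a) := by
  subst hρ
  set P : BipartiteMatrix n n := τ.permMatrix ℂ with hP
  set V := swapDiagonalizer n with hV
  have hVV : V * V = 1 := swapDiagonalizer_mul_self n
  have hKK : K.conjTranspose * K = 1 := Matrix.mem_unitaryGroup_iff'.1 hK
  -- This unitary takes the eigenbasis of the state to that of `swapWeight p`, with the labels
  -- permuted by `τ`.
  have hU : V * P * K.conjTranspose ∈ Matrix.unitaryGroup (Fin n × Fin n) ℂ :=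
    mul_mem (mul_mem (swapDiagonalizer_mem_unitaryGroup n) (permMatrix_mem_unitaryGroup τ))
      (Unitary.star_mem hK)
  have h1 := (h _ hU).dotProduct_mulVec_nonneg (schmidtVector p)
  rw [schmidtVector_dotProduct_partialTranspose, trace_mul_swapWeight] at h1
  have hconj : V * (V * P * K.conjTranspose *
      (K * Matrix.diagonal (fun b => (x b : ℂ)) * K.conjTranspose) *
      (V * P * K.conjTranspose).conjTranspose) * V =
      P * Matrix.diagonal (fun b => (x b : ℂ)) * P.conjTranspose := by
    rw [Matrix.conjTranspose_mul, Matrix.conjTranspose_mul, hV, swapDiagonalizer_conjTranspose,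
      Matrix.conjTranspose_conjTranspose, ← hV]
    calc _ = (V * V) * P * (K.conjTranspose * K) * Matrix.diagonal (fun b => (x b : ℂ)) *
          (K.conjTranspose * K) * P.conjTranspose * (V * V) := by simp only [Matrix.mul_assoc]
      _ = _ := by simp only [hVV, hKK, Matrix.one_mul, Matrix.mul_one]
  rw [← hV, hconj] at h1
  simp only [unitary_conj_diagonal_apply_self] at h1
  have h2 : ∀ a, ∑ b, ‖P a b‖ ^ 2 * x b = x (τ a) := by
    intro a
    simp [hP, Equiv.Perm.permMatrix, PEquiv.toMatrix_apply, Equiv.toPEquiv_apply, apply_ite]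
  simp only [h2] at h1
  exact_mod_cast h1

/-! ### Compactness and interior points -/

/-- Each sum has a positive minimum on the compact nonnegative part of the unit sphere; there are
finitely many permutations, and homogeneity of degree two extends the bound to all nonnegative `p`.
-/
theorem exists_pos_le_sum_pairMonomial {n : ℕ} {x : Fin n × Fin n → ℝ}
    (h : ∀ p : Fin n → ℝ, (∀ i, 0 ≤ p i) → p ≠ 0 → ∀ τ : Equiv.Perm (Fin n × Fin n),
      0 < ∑ a, pairMonomial p a * x (τ a)) :
    ∃ δ : ℝ, 0 < δ ∧ ∀ p : Fin n → ℝ, (∀ i, 0 ≤ p i) → ∀ τ : Equiv.Perm (Fin n × Fin n),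
      δ * ∑ i, p i ^ 2 ≤ ∑ a, pairMonomial p a * x (τ a) := by
  let S : Set (Fin n → ℝ) := {p | (∀ i, 0 ≤ p i) ∧ ∑ i, p i ^ 2 = 1}
  have hS : IsCompact S := by
    refine Metric.isCompact_of_isClosed_isBounded ?_ ?_
    · exact (isClosed_Ici (a := (0 : Fin n → ℝ))).inter
        (isClosed_eq (f := fun p : Fin n → ℝ => ∑ i, p i ^ 2) (by fun_prop) continuous_const)
    · refine (Metric.isBounded_Icc (0 : Fin n → ℝ) 1).subset fun p hp => ⟨hp.1, fun i => ?_⟩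
      have h1 : p i ^ 2 ≤ ∑ i, p i ^ 2 :=
        Finset.single_le_sum (f := fun i => p i ^ 2) (fun i _ => sq_nonneg _) (Finset.mem_univ i)
      rw [hp.2] at h1
      exact (sq_le_one_iff₀ (hp.1 i)).1 h1
  have hne : ∀ p ∈ S, p ≠ 0 := by
    rintro p hp rfl
    simpa using hp.2
  have hmin : ∀ τ : Equiv.Perm (Fin n × Fin n), ∃ δ : ℝ, 0 < δ ∧
      ∀ p ∈ S, δ ≤ ∑ a, pairMonomial p a * x (τ a) := by
    intro τ
    have hcont : Continuous fun p : Fin n → ℝ => ∑ a, pairMonomial p a * x (τ a) := by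
      unfold pairMonomial
      fun_prop
    rcases S.eq_empty_or_nonempty with hemp | hnem
    · exact ⟨1, one_pos, by simp [hemp]⟩
    · obtain ⟨p, hp, hmin⟩ := hS.exists_isMinOn hnem hcont.continuousOn
      exact ⟨_, h p hp.1 (hne p hp) τ, fun q hq => hmin hq⟩
  choose δ hδ0 hδ using hmin
  obtain ⟨τ₀, hτ₀⟩ := Finite.exists_min δ
  refine ⟨δ τ₀, hδ0 _, fun p hp τ => ?_⟩
  by_cases h0 : ∑ i, p i ^ 2 = 0
  · have : p = 0 := by
      funext i
      have := (Finset.sum_eq_zero_iff_of_nonneg fun i _ => sq_nonneg (p i)).1 h0 i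
        (Finset.mem_univ i)
      simpa using this
    simp [this, pairMonomial]
  · have hpos : 0 < ∑ i, p i ^ 2 :=
      lt_of_le_of_ne (Finset.sum_nonneg fun i _ => sq_nonneg _) (Ne.symm h0)
    set r := √(∑ i, p i ^ 2) with hr
    have hr0 : 0 < r := Real.sqrt_pos.2 hpos
    have hr2 : r ^ 2 = ∑ i, p i ^ 2 := Real.sq_sqrt hpos.le
    have hq : r⁻¹ • p ∈ S := by
      refine ⟨fun i => mul_nonneg (inv_nonneg.2 hr0.le) (hp i), ?_⟩
      simp only [Pi.smul_apply, smul_eq_mul, mul_pow, ← Finset.mul_sum, ← hr2]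
      field_simp
    have h1 := (hτ₀ τ).trans (hδ τ _ hq)
    simp only [pairMonomial_smul, mul_assoc, ← Finset.mul_sum] at h1
    rw [← hr2]
    calc δ τ₀ * r ^ 2 ≤ (r⁻¹ ^ 2 * ∑ a, pairMonomial p a * x (τ a)) * r ^ 2 := by gcongr
      _ = _ := by field_simp

theorem pairMonomial_single {n : ℕ} (i : Fin n) (a : Fin n × Fin n) :
    pairMonomial (Pi.single i 1) a = if a = (i, i) then 1 else 0 := by
  obtain ⟨j, k⟩ := a
  by_cases hj : j = i
  · by_cases hk : k = i
    · simp [pairMonomial, pairSign, hj, hk]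
    · simp [pairMonomial, hk]
  · simp [pairMonomial, hj]

/-- If all labelled sums of monomials are positive away from the origin, the state is interior. -/
theorem isInteriorPointAP_of_forall_pos {n : ℕ} (hn : 0 < n) {ρ K : BipartiteMatrix n n}
    (hK : K ∈ Matrix.unitaryGroup (Fin n × Fin n) ℂ) {x : Fin n × Fin n → ℝ}
    (hρK : ρ = K * Matrix.diagonal (fun b => (x b : ℂ)) * K.conjTranspose)
    (hρ : ρ ∈ AbsolutelyPPT n n)
    (h : ∀ p : Fin n → ℝ, (∀ i, 0 ≤ p i) → p ≠ 0 → ∀ τ : Equiv.Perm (Fin n × Fin n),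
      0 < ∑ a, pairMonomial p a * x (τ a)) : IsInteriorPointAP ρ := by
  obtain ⟨δ, hδ, hle⟩ := exists_pos_le_sum_pairMonomial h
  have hn' : (0 : ℝ) < n := Nat.cast_pos.2 hn
  have hnn : (0 : ℝ) < (n : ℝ) * n := mul_pos hn' hn'
  -- The second bound makes the subtracted multiple `c = ε / (n * n)` of the identity at most `δ`;
  -- the first keeps `ε` below one.
  set ε : ℝ := min (1 / 2) (δ * (n * n)) with hε
  have hε0 : 0 < ε := lt_min (by norm_num) (mul_pos hδ hnn)
  have hε1 : ε < 1 := (min_le_left _ _).trans_lt (by norm_num)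
  refine ⟨hρ, ε, hε0, hε1, ?_⟩
  set c : ℝ := ε / (n * n) with hc
  have hcδ : c ≤ δ := (div_le_iff₀ hnn).2 (min_le_right _ _)
  have h1ε : 0 < 1 - ε := sub_pos.2 hε1
  set y : Fin n × Fin n → ℝ := fun b => 1 / (1 - ε) * (x b - c) with hy
  have hKK : K * K.conjTranspose = 1 := Matrix.mem_unitaryGroup_iff.1 hK
  have hy_diag : (1 / (1 - ε)) • (ρ - c • (1 : BipartiteMatrix n n)) =
      K * Matrix.diagonal (fun b => (y b : ℂ)) * K.conjTranspose := by
    have h1 : Matrix.diagonal (fun b => (y b : ℂ)) =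
        (1 / (1 - ε)) • (Matrix.diagonal (fun b => (x b : ℂ)) - c • (1 : BipartiteMatrix n n)) := by
      ext a b
      by_cases hab : a = b
      · subst hab
        simp [hy]
      · simp [hab]
    rw [h1, hρK, Matrix.mul_smul, Matrix.smul_mul, Matrix.mul_sub, Matrix.sub_mul, Matrix.mul_smul,
      Matrix.smul_mul, Matrix.mul_one, hKK]
  have hsum : ∀ p : Fin n → ℝ, (∀ i, 0 ≤ p i) → ∀ τ : Equiv.Perm (Fin n × Fin n),
      0 ≤ ∑ a, pairMonomial p a * y (τ a) := by
    intro p hp τ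
    have h1 : ∑ a, pairMonomial p a * y (τ a) =
        1 / (1 - ε) * (∑ a, pairMonomial p a * x (τ a) - c * ∑ i, p i ^ 2) := by
      rw [← sum_pairMonomial, Finset.mul_sum, ← Finset.sum_sub_distrib, Finset.mul_sum]
      exact Finset.sum_congr rfl fun a _ => by simp only [hy]; ring
    rw [h1]
    refine mul_nonneg (by positivity) (sub_nonneg.2 ((mul_le_mul_of_nonneg_right hcδ ?_).trans
      (hle p hp τ)))
    positivity
  have hy0 : ∀ b, 0 ≤ y b := by
    intro b
    -- At a basis vector only one monomial is nonzero, so the labelled sum reduces to the single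
    -- weight `y b`.
    have h1 := hsum (Pi.single ⟨0, hn⟩ 1) (fun i => by
      rw [Pi.single_apply]; split_ifs <;> norm_num) (Equiv.swap (⟨0, hn⟩, ⟨0, hn⟩) b)
    simpa [pairMonomial_single] using h1
  rw [hy_diag]
  refine ⟨⟨?_, ?_⟩, fun U hU => ?_⟩
  · exact (Matrix.PosSemidef.diagonal fun b => Complex.zero_le_real.2 (hy0 b)).mul_mul_conjTranspose_same K
  · rw [← hy_diag, Matrix.trace_smul, Matrix.trace_sub, Matrix.trace_smul, hρ.1.trace_eq_one,
      Matrix.trace_one, hc]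
    simp only [Fintype.card_prod, Fintype.card_fin, Complex.real_smul]
    have h3 : ((1 - ε : ℝ) : ℂ) ≠ 0 := by exact_mod_cast h1ε.ne'
    have h4 : (n : ℂ) ≠ 0 := by exact_mod_cast hn.ne'
    push_cast at h3 ⊢
    field_simp
  · have h1 : U * (K * Matrix.diagonal (fun b => (y b : ℂ)) * K.conjTranspose) * U.conjTranspose =
        (U * K) * Matrix.diagonal (fun b => (y b : ℂ)) * (U * K).conjTranspose := by
      rw [Matrix.conjTranspose_mul]
      simp only [Matrix.mul_assoc]
    rw [h1]
    exact partialTranspose_posSemidef_of_forall (mul_mem hU hK) hsum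

/-! ### Sorted spectra and the conclusion -/

theorem eq_eigenvectorUnitary_conj {ι : Type*} [Fintype ι] [DecidableEq ι] {M : Matrix ι ι ℂ}
    (hM : M.IsHermitian) :
    M = (hM.eigenvectorUnitary : Matrix ι ι ℂ) *
      Matrix.diagonal (fun b => (hM.eigenvalues b : ℂ)) *
      (hM.eigenvectorUnitary : Matrix ι ι ℂ).conjTranspose := by
  have h := hM.spectral_theorem
  rw [Unitary.conjStarAlgAut_apply] at h
  exact h

/-- The labelling of the eigenvalues by pairs that Mathlib uses to define `eigenvalues`. -/
noncomputable def eigenvalueLabelling (ι : Type*) [Fintype ι] : Fin (Fintype.card ι) ≃ ι :=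
  Fintype.equivOfCardEq (Fintype.card_fin _)

theorem sum_eigenvalueVector_mul {ι : Type*} [Fintype ι] [DecidableEq ι] {M : Matrix ι ι ℂ}
    (hM : M.IsHermitian) (f : ι → ℝ) (π : Fin (Fintype.card ι) ≃ ι) :
    ∑ k, eigenvalueVector hM k * f (π k) =
      ∑ a, f a * hM.eigenvalues ((π.symm.trans (eigenvalueLabelling ι)) a) := by
  rw [← π.sum_comp]
  refine Finset.sum_congr rfl fun k _ => ?_
  simp [Matrix.IsHermitian.eigenvalues, eigenvalueVector, eigenvalueLabelling, mul_comm]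

theorem AbsolutelyPPT.sum_eigenvalueVector_nonneg {n : ℕ} {ρ : BipartiteMatrix n n}
    (hρ : ρ ∈ AbsolutelyPPT n n) (hH : ρ.IsHermitian)
    (π : Fin (Fintype.card (Fin n × Fin n)) ≃ Fin n × Fin n) (q : Fin n → ℝ) :
    0 ≤ ∑ k, eigenvalueVector hH k * pairMonomial q (π k) := by
  rw [sum_eigenvalueVector_mul hH]
  exact sum_pairMonomial_nonneg hH.eigenvectorUnitary.2 (eq_eigenvectorUnitary_conj hH) hρ.2 q _

/-- A boundary state has a Schmidt vector and a labelling of its eigenvalues at which the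
associated sum of monomials is not positive. -/
theorem IsBoundaryPointAP.exists_sum_nonpos {n : ℕ} (hn : 0 < n) {ρ : BipartiteMatrix n n}
    (hρ : IsBoundaryPointAP ρ) (hH : ρ.IsHermitian) :
    ∃ p : Fin n → ℝ, (∀ i, 0 ≤ p i) ∧ p ≠ 0 ∧
      ∃ π : Fin (Fintype.card (Fin n × Fin n)) ≃ Fin n × Fin n,
        ∑ k, eigenvalueVector hH k * pairMonomial p (π k) ≤ 0 := by
  by_contra! hcon
  refine hρ.2 (isInteriorPointAP_of_forall_pos hn (K := hH.eigenvectorUnitary)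
    hH.eigenvectorUnitary.2 (eq_eigenvectorUnitary_conj hH) hρ.1 fun p hp0 hp1 τ => ?_)
  -- The labelling is chosen so that its inverse followed by `eigenvalueLabelling` is `τ`.
  have h := hcon p hp0 hp1 ((eigenvalueLabelling _).trans τ.symm)
  rw [sum_eigenvalueVector_mul hH] at h
  simpa using h

theorem theorem4p2 (ρ σ : BipartiteMatrix 3 3) (hρ : IsState ρ) (hσ : IsState σ)
    (hbd : IsBoundaryPointAP ρ)
    (hmaj : HermMajorizes hσ.isHermitian hρ.isHermitian)
    (hne : eigenvalueVector hσ.isHermitian ≠ eigenvalueVector hρ.isHermitian) :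
    σ ∉ AbsolutelyPPT 3 3 := by
  intro hσA
  obtain ⟨p, hp0, hp1, π, hp⟩ := hbd.exists_sum_nonpos (by norm_num) hρ.isHermitian
  exact hne (eq_of_vecMajorizes hρ.isHermitian.eigenvalues₀_antitone
    hσ.isHermitian.eigenvalues₀_antitone hmaj
    (AbsolutelyPPT.sum_eigenvalueVector_nonneg hbd.1 _)
    (AbsolutelyPPT.sum_eigenvalueVector_nonneg hσA _) hp0 hp1 hp)
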